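/- Let $E$ be a finite-dimensional complex Hilbert space, with $L^2(E)$, $L^2(\mathcal L(E))$ the spaces of square integrable functions on the unit circle $\mathbb T$ with values in $E$, respectively in $\mathcal L(E)$, and $H^2(E)$, $H^2(\mathcal L(E))$ their subspaces of functions whose negative Fourier coefficients vanish. Let $\Theta\in H^2(\mathcal L(E))$ be a pure inner function: $\Theta(e^{it})$ is unitary for almost every $t$, and $\|\Theta(0)\|<1$. Let $K_\Theta=H^2(E)\ominus\Theta H^2(E)$, let $P_\Theta$ be the orthogonal projection of $L^2(E)$ onto $K_\Theta$, let $S_\Theta f=P_\Theta(zf)$ for $f\in K_\Theta$, and let $$\mathcal D=\{(I-\Theta(z)\Theta(0)^*)x : x\in E\}\subset K_\Theta ,$$ which contains the range of $I-S_\Theta S_\Theta^*$. Let $\Omega:\mathcal D\to E$ be the (well-defined) linear operator with $\Omega\big((I-\Theta(z)\Theta(0)^*)x\big)=x$; equivalently, $\Omega(I-S_\Theta S_\Theta^*)f=f(0)$ for $f\in K_\Theta$. For $\Phi\in L^2(\mathcal L(E))$ and a bounded operator $A$ on $K_\Theta$, write $A=A_\Phi$ if $Af=P_\Theta(\Phi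 f)$ for all bounded functions $f\in K_\Theta$; $A$ is a matrix-valued truncated Toeplitz operator if $A=A_\Phi$ for some $\Phi\in L^2(\mathcal L(E))$. For $\Phi\in H^2(\mathcal L(E))$ let $P_\Theta M_\Phi\Omega:\mathcal D\to K_\Theta$ be the operator $g\mapsto P_\Theta(\Phi\cdot\Omega g)$, where $\Omega g\in E$ is regarded as a constant function. Theorem. Let $A$ be a bounded operator on $K_\Theta$. For operators $B,B':\mathcal D\to K_\Theta$ consider the relation $$A-S_\Theta A S_\Theta^*=B(I-S_\Theta S_\Theta^*)+(I-S_\Theta S_\Theta^*)B'^*.\qquad(*)$$ 1. $A$ is a matrix-valued truncated Toeplitz operator if and only if $(*)$ holds for some operators $B,B':\mathcal D\to K_\Theta$. 2. If $B,B'$ satisfy $(*)$, then there are $\Phi,\Phi'\in H^2(\mathcal L(E))$ such that $A=A_{\Phi+\Phi'^*}$, $B=P_\Theta M_\Phi\Omega$ and $B'=P_\Theta M_{\Phi'}\Omega$. 3. Conversely, if $A=A_{\Phi+\Phi'^*}$ with $\Phi,\Phi'\in H^2(\mathcal L(E))$, then $(*)$ holds with $B=P_\Theta M_\Phi\Omega$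 and $B'=P_\Theta M_{\Phi'}\Omega$. -/

import Mathlib

open MeasureTheory
open scoped ENNReal InnerProductSpace

noncomputable section

namespace MTTO

/-- The length `2π` of the circle is positive; the point `t` of `AddCircle (2π)` stands for
`e^{it}` on the unit circle. -/
instance factTwoPi : Fact (0 < 2 * Real.pi) := ⟨Real.two_pi_pos⟩

/-- Normalized Lebesgue (Haar) measure `dt / 2π` on the circle. -/
abbrev circMeasure : Measure (AddCircle (2 * Real.pi)) := AddCircle.haarAddCircle

/-- `L²(F)`: square integrable functions on the unit circle with values in `F`. -/
abbrev L2 (F : Type*) [NormedAddCommGroup F] := Lp F 2 circMeasure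

/-- `L^∞(F)`: essentially bounded functions on the unit circle with values in `F`. -/
abbrev LInf (F : Type*) [NormedAddCommGroup F] := Lp F ∞ circMeasure

theorem integrable_L2 {F : Type*} [NormedAddCommGroup F] (f : L2 F) : Integrable f circMeasure :=
  (Lp.memLp f).integrable (by norm_num)

section General

variable {F : Type*} [NormedAddCommGroup F] [NormedSpace ℂ F]

/-- The `n`-th Fourier coefficient as a bounded linear map on `L²(F)`. -/
def coeffL (n : ℤ) : L2 F →L[ℂ] F :=
  LinearMap.mkContinuous
    { toFun := fun f => fourierCoeff f n
      map_add' := fun f g => by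
        rw [fourierCoeff_congr_ae (Lp.coeFn_add f g),
          fourierCoeff.add (integrable_L2 f) (integrable_L2 g)]
        rfl
      map_smul' := fun c f => by
        rw [fourierCoeff_congr_ae (Lp.coeFn_smul c f)]
        exact fourierCoeff.const_smul _ c n }
    1 (fun f => by
      have h1 : ‖fourierCoeff f n‖ ≤ ∫ t, ‖f t‖ ∂circMeasure := by
        refine (norm_integral_le_integral_norm _).trans (le_of_eq ?_)
        refine integral_congr_ae (Filter.Eventually.of_forall fun t => ?_)
        simp only [norm_smul, fourier_apply, Circle.norm_coe, one_mul]
      have h2 : ∫ t, ‖f t‖ ∂circMeasure = (eLpNorm f 1 circMeasure).toReal := by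
        rw [eLpNorm_one_eq_lintegral_enorm,
          integral_norm_eq_lintegral_enorm (Lp.aestronglyMeasurable f)]
      have h3 : (eLpNorm f 1 circMeasure).toReal ≤ ‖f‖ := by
        rw [Lp.norm_def]
        exact ENNReal.toReal_mono (Lp.eLpNorm_ne_top f)
          (eLpNorm_le_eLpNorm_of_exponent_le (by norm_num) (Lp.aestronglyMeasurable f))
      change ‖fourierCoeff f n‖ ≤ 1 * ‖f‖
      linarith)

@[simp] theorem coeffL_apply (n : ℤ) (f : L2 F) : coeffL n f = fourierCoeff f n := rfl

variable (F) in
/-- The Hardy space `H²(F)`: the functions in `L²(F)` whose negative Fourier coefficients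
vanish. -/
def hardy : Submodule ℂ (L2 F) where
  carrier := {f | ∀ n : ℤ, n < 0 → fourierCoeff f n = 0}
  add_mem' {f g} hf hg n hn := by
    rw [← coeffL_apply, map_add, coeffL_apply, coeffL_apply, hf n hn, hg n hn, add_zero]
  zero_mem' n _ := by rw [← coeffL_apply, map_zero]
  smul_mem' c f hf n hn := by
    rw [← coeffL_apply, map_smul, coeffL_apply, hf n hn, smul_zero]

theorem mem_hardy {f : L2 F} : f ∈ hardy F ↔ ∀ n : ℤ, n < 0 → fourierCoeff f n = 0 := Iff.rfl

theorem isClosed_hardy : IsClosed (hardy F : Set (L2 F)) := by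
  have : (hardy F : Set (L2 F)) = ⋂ n : ℤ, ⋂ _ : n < 0, {f | coeffL n f = 0} := by
    ext f; simp [mem_hardy]
  rw [this]
  exact isClosed_iInter fun n => isClosed_iInter fun _ =>
    isClosed_eq (coeffL n).continuous continuous_const

/-- The value at the point `w` of the disc of the analytic function `∑_{n ≥ 0} a_n w^n` that an
element of the Hardy space with Fourier coefficients `a_n` represents. -/
def discValue (f : L2 F) (w : ℂ) : F := ∑' n : ℕ, w ^ n • fourierCoeff f (n : ℤ)

theorem discValue_zero (f : L2 F) : discValue f 0 = fourierCoeff f 0 := by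
  rw [discValue, tsum_eq_single 0]
  · simp
  · intro n hn; simp [hn]

/-- Multiplication by `z^n`, where `z = e^{it}`, as a bounded operator on `L²(F)`. -/
def mulZ (n : ℤ) : L2 F →L[ℂ] L2 F :=
  (ContinuousLinearMap.lsmul ℂ ℂ : ℂ →L[ℂ] F →L[ℂ] F).holderL circMeasure ∞ 2 2 (fourierLp ∞ n)

theorem coeFn_mulZ (n : ℤ) (f : L2 F) :
    mulZ n f =ᵐ[circMeasure] fun t => fourier n t • f t := by
  have h1 := ContinuousLinearMap.coeFn_holder (r := 2)
    (ContinuousLinearMap.lsmul ℂ ℂ : ℂ →L[ℂ] F →L[ℂ] F)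
    (fourierLp (T := 2 * Real.pi) ∞ n) f
  filter_upwards [h1, coeFn_fourierLp (T := 2 * Real.pi) ∞ n] with t h1 h2
  have : mulZ n f t = _ := h1
  rw [this, h2]; rfl

theorem coeff_mulZ (m n : ℤ) (f : L2 F) :
    fourierCoeff (mulZ m f) n = fourierCoeff f (n - m) := by
  rw [fourierCoeff_congr_ae (coeFn_mulZ m f)]
  simp only [fourierCoeff, smul_smul]
  congr 1; ext t
  rw [← fourier_add]; congr 2; ring_nf

theorem mulZ_mulZ (m n : ℤ) (f : L2 F) : mulZ m (mulZ n f) = mulZ (m + n) f := by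
  apply Lp.ext
  filter_upwards [coeFn_mulZ m (mulZ n f), coeFn_mulZ n f, coeFn_mulZ (m + n) f] with t h1 h2 h3
  rw [h1, h2, h3, smul_smul, fourier_add]

theorem mulZ_zero (f : L2 F) : mulZ 0 f = f := by
  apply Lp.ext
  filter_upwards [coeFn_mulZ 0 f] with t h1
  rw [h1]; simp

/-- The constant functions, as elements of `L²(F)`. -/
abbrev constL2 : F →L[ℂ] L2 F := Lp.constL 2 circMeasure ℂ

theorem coeff_const (x : F) (n : ℤ) [CompleteSpace F] :
    fourierCoeff (constL2 x) n = if n = 0 then x else 0 := by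
  have h : (constL2 x : L2 F) =ᵐ[circMeasure] fun _ => x := Lp.coeFn_const ..
  rw [fourierCoeff_congr_ae h, fourierCoeff, integral_smul_const]
  have h2 := orthonormal_iff_ite.mp (orthonormal_fourier (T := 2 * Real.pi)) n 0
  rw [L2.inner_def] at h2
  have h3 : ∫ t, (fourier (-n) t : ℂ) ∂circMeasure = if n = 0 then 1 else 0 := by
    rw [← h2]
    refine integral_congr_ae ?_
    filter_upwards [coeFn_fourierLp (T := 2 * Real.pi) 2 n,
      coeFn_fourierLp (T := 2 * Real.pi) 2 0] with t h1 h2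
    rw [h1, h2]; simp
  rw [h3]; split_ifs <;> simp

end General

section Inner

variable {E : Type*} [NormedAddCommGroup E] [InnerProductSpace ℂ E] [CompleteSpace E]

/-- `Θ` is an inner function: it lies in `H²(L(E))` and its boundary values are almost everywhere
unitary operators on `E`. -/
structure IsInner (Θ : L2 (E →L[ℂ] E)) : Prop where
  mem_hardy : Θ ∈ hardy (E →L[ℂ] E)
  unitary : ∀ᵐ t ∂circMeasure, Θ t ∈ unitary (E →L[ℂ] E)

/-- The inner function `Θ` is pure: `‖Θ(0)‖ < 1`. -/
def IsPure (Θ : L2 (E →L[ℂ] E)) : Prop := ‖discValue Θ 0‖ < 1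

/-- The subspace `Θ H²(E)` of `L²(E)`. -/
def thetaHardy (Θ : L2 (E →L[ℂ] E)) : Submodule ℂ (L2 E) where
  carrier := {g | ∃ f ∈ hardy E, g =ᵐ[circMeasure] fun t => Θ t (f t)}
  add_mem' := by
    rintro g g' ⟨f, hf, h⟩ ⟨f', hf', h'⟩
    refine ⟨f + f', add_mem hf hf', ?_⟩
    filter_upwards [h, h', Lp.coeFn_add f f', Lp.coeFn_add g g'] with t h1 h2 h3 h4
    change (g + g' : L2 E) t = Θ t ((f + f' : L2 E) t)
    simp only [h1, h2, h3, h4, Pi.add_apply, map_add]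
  zero_mem' := by
    refine ⟨0, zero_mem _, ?_⟩
    filter_upwards [Lp.coeFn_zero E 2 circMeasure] with t h1
    rw [h1, Pi.zero_apply, map_zero]
  smul_mem' := by
    rintro c g ⟨f, hf, h⟩
    refine ⟨c • f, Submodule.smul_mem _ c hf, ?_⟩
    filter_upwards [h, Lp.coeFn_smul c f, Lp.coeFn_smul c g] with t h1 h2 h3
    simp [h1, h2, h3]

/-- The model space `K_Θ = H²(E) ⊖ Θ H²(E)`. -/
def modelSpace (Θ : L2 (E →L[ℂ] E)) : Submodule ℂ (L2 E) := hardy E ⊓ (thetaHardy Θ)ᗮ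

instance completeSpace_modelSpace (Θ : L2 (E →L[ℂ] E)) : CompleteSpace (modelSpace Θ) :=
  ((isClosed_hardy (F := E)).inter
    (Submodule.isClosed_orthogonal (thetaHardy Θ))).completeSpace_coe

/-- `P_Θ`: the orthogonal projection of `L²(E)` onto the model space. -/
def projModel (Θ : L2 (E →L[ℂ] E)) : L2 E →L[ℂ] modelSpace Θ :=
  (modelSpace Θ).orthogonalProjectionOnto

/-- The model operator `S_Θ f = P_Θ (z f)` on `K_Θ`. -/
def modelOp (Θ : L2 (E →L[ℂ] E)) : modelSpace Θ →L[ℂ] modelSpace Θ :=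
  projModel Θ ∘L mulZ 1 ∘L (modelSpace Θ).subtypeL

/-- Multiplication `M_Φ f = Φ f` by `Φ ∈ L²(L(E))`, from bounded functions to `L²(E)`. -/
def mulOp (Φ : L2 (E →L[ℂ] E)) : LInf E →L[ℂ] L2 E :=
  (ContinuousLinearMap.id ℂ (E →L[ℂ] E)).holderL circMeasure 2 ∞ 2 Φ

theorem coeFn_mulOp (Φ : L2 (E →L[ℂ] E)) (f : LInf E) :
    mulOp Φ f =ᵐ[circMeasure] fun t => Φ t (f t) :=
  ContinuousLinearMap.coeFn_holder (r := 2) (ContinuousLinearMap.id ℂ (E →L[ℂ] E)) Φ f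

/-- `A = A_Φ`: the bounded operator `A` on `K_Θ` satisfies `A f = P_Θ (Φ f)` for all bounded
functions `f` in `K_Θ`. As these are dense in `K_Θ`, there is at most one such `A`, and there is
one exactly when the densely defined map `f ↦ P_Θ (Φ f)` is bounded. -/
def HasSymbol (Θ : L2 (E →L[ℂ] E)) (A : modelSpace Θ →L[ℂ] modelSpace Θ)
    (Φ : L2 (E →L[ℂ] E)) : Prop :=
  ∀ (f : modelSpace Θ) (hf : MemLp (f : L2 E) ∞ circMeasure),
    A f = projModel Θ (mulOp Φ hf.toLp)

/-- `A` is a matrix-valued truncated Toeplitz operator on `K_Θ`: `A = A_Φ` for some symbol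
`Φ ∈ L²(L(E))`. -/
def IsMTTO (Θ : L2 (E →L[ℂ] E)) (A : modelSpace Θ →L[ℂ] modelSpace Θ) : Prop :=
  ∃ Φ : L2 (E →L[ℂ] E), HasSymbol Θ A Φ

/-- The operator `I - S_Θ S_Θ*` on `K_Θ`. -/
def defectOp (Θ : L2 (E →L[ℂ] E)) : modelSpace Θ →L[ℂ] modelSpace Θ :=
  ContinuousLinearMap.id ℂ (modelSpace Θ) - modelOp Θ ∘L (modelOp Θ).adjoint

/-- The function `(I - Θ(z) Θ(0)*) x`. -/
def kernelZero (Θ : L2 (E →L[ℂ] E)) (x : E) : L2 E :=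
  constL2 x - mulOp Θ (Lp.constL ∞ circMeasure ℂ ((discValue Θ 0).adjoint x))

/-- The defect space `D = {(I - Θ(z) Θ(0)*) x : x ∈ E}`, as a subspace of `K_Θ`. -/
def defectSpace (Θ : L2 (E →L[ℂ] E)) : Submodule ℂ (modelSpace Θ) where
  carrier := {f | ∃ x : E, (f : L2 E) = kernelZero Θ x}
  add_mem' := by
    rintro f g ⟨x, hx⟩ ⟨y, hy⟩
    refine ⟨x + y, ?_⟩
    rw [Submodule.coe_add, hx, hy]
    simp only [kernelZero, map_add]; abel
  zero_mem' := ⟨0, by simp [kernelZero]⟩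
  smul_mem' := by
    rintro c f ⟨x, hx⟩
    refine ⟨c • x, ?_⟩
    rw [Submodule.coe_smul, hx]
    simp only [kernelZero, map_smul, smul_sub]

theorem inner_constL2 (x : E) (f : L2 E) : ⟪(constL2 x : L2 E), f⟫_ℂ = ⟪x, fourierCoeff f 0⟫_ℂ := by
  have h : (constL2 x : L2 E) =ᵐ[circMeasure] fun _ => x := Lp.coeFn_const ..
  rw [L2.inner_def, fourierCoeff, ← integral_inner]
  · refine integral_congr_ae ?_
    filter_upwards [h] with t h
    rw [h]; simp
  · exact (integrable_L2 f).fourier_smul _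

theorem inner_mulZ_left (n : ℤ) (f g : L2 E) : ⟪mulZ n f, g⟫_ℂ = ⟪f, mulZ (-n) g⟫_ℂ := by
  rw [L2.inner_def, L2.inner_def]
  refine integral_congr_ae ?_
  filter_upwards [coeFn_mulZ n f, coeFn_mulZ (-n) g] with t h1 h2
  rw [h1, h2, inner_smul_left, inner_smul_right, fourier_neg]

theorem inner_mulZ_const (n : ℤ) (x : E) (f : L2 E) :
    ⟪mulZ n (constL2 x : L2 E), f⟫_ℂ = ⟪x, fourierCoeff f n⟫_ℂ := by
  rw [inner_mulZ_left, inner_constL2, coeff_mulZ]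
  simp

theorem const_mem_hardy (x : E) : (constL2 x : L2 E) ∈ hardy E := fun n hn => by
  rw [coeff_const, if_neg hn.ne]

theorem mulZ_mem_hardy {f : L2 E} (hf : f ∈ hardy E) : mulZ 1 f ∈ hardy E := fun n hn => by
  rw [coeff_mulZ]; exact hf _ (by omega)

theorem mulZ_const_mem_hardy (n : ℕ) (x : E) : mulZ n (constL2 x : L2 E) ∈ hardy E :=
  fun k hk => by
    rw [coeff_mulZ, coeff_const, if_neg (by omega)]

variable [FiniteDimensional ℂ E]

theorem eq_zero_of_coeff (f : L2 E) (hf : ∀ n, fourierCoeff f n = 0) : f = 0 := by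
  have key : ∀ y : E, ∀ᵐ t ∂circMeasure, ⟪y, f t⟫_ℂ = 0 := by
    intro y
    have hm : MemLp (fun t => innerSL ℂ y (f t)) 2 circMeasure :=
      ContinuousLinearMap.comp_memLp' (innerSL ℂ y) (Lp.memLp f)
    have h0 : hm.toLp = 0 := by
      apply (fourierBasis (T := 2 * Real.pi)).repr.injective
      rw [map_zero]
      ext n
      rw [fourierBasis_repr, fourierCoeff_congr_ae hm.coeFn_toLp]
      have := ContinuousLinearMap.integral_comp_comm (innerSL ℂ y)
        ((integrable_L2 f).fourier_smul (-n))
      simp only [map_smul] at this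
      have h2 := hf n
      rw [fourierCoeff] at h2
      rw [fourierCoeff, this, h2]; simp
    filter_upwards [hm.coeFn_toLp, Lp.coeFn_zero ℂ 2 circMeasure] with t h1 h2
    rw [h0, h2] at h1
    exact h1.symm
  apply Lp.ext
  have := ae_all_iff.2 fun i => key (stdOrthonormalBasis ℂ E i)
  filter_upwards [this, Lp.coeFn_zero E 2 circMeasure] with t h1 h2
  rw [h2]
  apply (stdOrthonormalBasis ℂ E).repr.injective
  ext i
  rw [OrthonormalBasis.repr_apply_apply, h1]; simp

/-- A closed subspace that contains all `z^n x`, `n ≥ 0`, contains `H²(E)`. -/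
theorem hardy_le (V : Submodule ℂ (L2 E)) (hV : IsClosed (V : Set (L2 E)))
    (h : ∀ (n : ℕ) (x : E), mulZ n (constL2 x : L2 E) ∈ V) : hardy E ≤ V := by
  intro f hf
  let U := V ⊓ hardy E
  have hU : IsClosed (U : Set (L2 E)) := hV.inter isClosed_hardy
  have : CompleteSpace U := hU.completeSpace_coe
  have hg : f - U.starProjection f ∈ Uᗮ := Submodule.sub_starProjection_mem_orthogonal f
  have hP : U.starProjection f ∈ U := Submodule.starProjection_apply_mem U f
  have hz : f - U.starProjection f = 0 := by
    apply eq_zero_of_coeff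
    intro n
    rcases lt_or_ge n 0 with hn | hn
    · exact (hardy E).sub_mem hf hP.2 n hn
    · lift n to ℕ using hn
      apply ext_inner_left ℂ
      intro x
      rw [← inner_mulZ_const, inner_zero_right]
      exact hg _ ⟨h n x, mulZ_const_mem_hardy n x⟩
  rw [sub_eq_zero.1 hz]
  exact hP.1

section Theta

variable {Θ : L2 (E →L[ℂ] E)}

theorem IsInner.memLp_top (hΘ : IsInner Θ) : MemLp Θ ∞ circMeasure := by
  refine memLp_top_of_bound (Lp.aestronglyMeasurable Θ) 1 ?_
  filter_upwards [hΘ.unitary] with t ht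
  refine ContinuousLinearMap.opNorm_le_bound _ zero_le_one fun x => ?_
  rw [one_mul, ContinuousLinearMap.norm_map_of_mem_unitary ht]

/-- Multiplication by an inner function on `L²(E)`. -/
def thetaMul (hΘ : IsInner Θ) : L2 E →L[ℂ] L2 E :=
  (ContinuousLinearMap.id ℂ (E →L[ℂ] E)).holderL circMeasure ∞ 2 2 hΘ.memLp_top.toLp

theorem coeFn_thetaMul (hΘ : IsInner Θ) (f : L2 E) :
    thetaMul hΘ f =ᵐ[circMeasure] fun t => Θ t (f t) := by
  have h1 := ContinuousLinearMap.coeFn_holder (r := 2)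
    (ContinuousLinearMap.id ℂ (E →L[ℂ] E)) hΘ.memLp_top.toLp f
  filter_upwards [h1, hΘ.memLp_top.coeFn_toLp] with t h1 h2
  have : thetaMul hΘ f t = _ := h1
  rw [this, h2]; rfl

theorem thetaMul_inner (hΘ : IsInner Θ) (f g : L2 E) :
    ⟪thetaMul hΘ f, thetaMul hΘ g⟫_ℂ = ⟪f, g⟫_ℂ := by
  rw [L2.inner_def, L2.inner_def]
  refine integral_congr_ae ?_
  filter_upwards [coeFn_thetaMul hΘ f, coeFn_thetaMul hΘ g, hΘ.unitary] with t h1 h2 h3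
  rw [h1, h2, ContinuousLinearMap.inner_map_map_of_mem_unitary h3]

theorem thetaMul_mulZ (hΘ : IsInner Θ) (n : ℤ) (f : L2 E) :
    thetaMul hΘ (mulZ n f) = mulZ n (thetaMul hΘ f) := by
  apply Lp.ext
  filter_upwards [coeFn_thetaMul hΘ (mulZ n f), coeFn_mulZ n f,
    coeFn_mulZ n (thetaMul hΘ f), coeFn_thetaMul hΘ f] with t h1 h2 h3 h4
  rw [h1, h2, h3, h4, map_smul]

theorem mem_thetaHardy (hΘ : IsInner Θ) {g : L2 E} :
    g ∈ thetaHardy Θ ↔ ∃ f ∈ hardy E, thetaMul hΘ f = g := by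
  constructor
  · rintro ⟨f, hf, h⟩
    exact ⟨f, hf, Lp.ext ((coeFn_thetaMul hΘ f).trans h.symm)⟩
  · rintro ⟨f, hf, rfl⟩
    exact ⟨f, hf, coeFn_thetaMul hΘ f⟩

theorem coeff_thetaMul_const (hΘ : IsInner Θ) (x : E) (n : ℤ) :
    fourierCoeff (thetaMul hΘ (constL2 x)) n = fourierCoeff Θ n x := by
  have h : (constL2 x : L2 E) =ᵐ[circMeasure] fun _ => x := Lp.coeFn_const ..
  have h2 : thetaMul hΘ (constL2 x) =ᵐ[circMeasure] fun t => Θ t x := by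
    filter_upwards [coeFn_thetaMul hΘ (constL2 x), h] with t h1 h2
    rw [h1, h2]
  rw [fourierCoeff_congr_ae h2, fourierCoeff, fourierCoeff,
    ContinuousLinearMap.integral_apply ((integrable_L2 Θ).fourier_smul _)]
  rfl

theorem thetaMul_mem_hardy (hΘ : IsInner Θ) {f : L2 E} (hf : f ∈ hardy E) :
    thetaMul hΘ f ∈ hardy E := by
  refine hardy_le ((hardy E).comap (thetaMul hΘ).toLinearMap)
    (isClosed_hardy.preimage (thetaMul hΘ).continuous) (fun n x => ?_) hf
  intro k hk
  change fourierCoeff (thetaMul hΘ (mulZ n (constL2 x))) k = 0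
  rw [thetaMul_mulZ, coeff_mulZ, coeff_thetaMul_const, hΘ.mem_hardy _ (by omega)]
  rfl

theorem coeff_zero_thetaMul (hΘ : IsInner Θ) {f : L2 E} (hf : f ∈ hardy E) :
    fourierCoeff (thetaMul hΘ f) 0 = fourierCoeff Θ 0 (fourierCoeff f 0) := by
  let L : L2 E →L[ℂ] E := coeffL 0 ∘L thetaMul hΘ - (fourierCoeff Θ 0) ∘L coeffL 0
  have : f ∈ L.ker := by
    refine hardy_le L.ker L.isClosed_ker (fun n x => ?_) hf
    change fourierCoeff (thetaMul hΘ (mulZ n (constL2 x))) 0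
      - fourierCoeff Θ 0 (fourierCoeff (mulZ n (constL2 x : L2 E)) 0) = 0
    rw [thetaMul_mulZ, coeff_mulZ, coeff_mulZ, coeff_thetaMul_const, coeff_const]
    rcases Nat.eq_zero_or_pos n with rfl | hn
    · simp
    · rw [if_neg (by omega), hΘ.mem_hardy _ (by omega)]; simp
  exact sub_eq_zero.1 this

theorem kernelZero_eq (hΘ : IsInner Θ) (x : E) :
    kernelZero Θ x = constL2 x - thetaMul hΘ (constL2 ((discValue Θ 0).adjoint x)) := by
  rw [kernelZero]; congr 1
  apply Lp.ext
  set y := (discValue Θ 0).adjoint x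
  have h : (constL2 y : L2 E) =ᵐ[circMeasure] fun _ => y := Lp.coeFn_const ..
  have h' : (Lp.constL ∞ circMeasure ℂ y : LInf E) =ᵐ[circMeasure] fun _ => y :=
    Lp.coeFn_const ..
  filter_upwards [coeFn_mulOp Θ (Lp.constL ∞ circMeasure ℂ y),
    coeFn_thetaMul hΘ (constL2 y), h, h'] with t h1 h2 h3 h4
  rw [h1, h2, h3, h4]

theorem kernelZero_mem (hΘ : IsInner Θ) (x : E) : kernelZero Θ x ∈ modelSpace Θ := by
  rw [kernelZero_eq hΘ]
  refine ⟨sub_mem (const_mem_hardy x) (thetaMul_mem_hardy hΘ (const_mem_hardy _)), ?_⟩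
  rw [SetLike.mem_coe, Submodule.mem_orthogonal']
  intro g hg
  obtain ⟨f, hf, rfl⟩ := (mem_thetaHardy hΘ).1 hg
  rw [inner_sub_left, thetaMul_inner, inner_constL2, inner_constL2, coeff_zero_thetaMul hΘ hf,
    ContinuousLinearMap.adjoint_inner_left, discValue_zero, sub_self]

theorem projModel_const (hΘ : IsInner Θ) (x : E) :
    (projModel Θ (constL2 x) : L2 E) = kernelZero Θ x := by
  refine Submodule.eq_starProjection_of_mem_orthogonal (K := modelSpace Θ)
    (kernelZero_mem hΘ x) ?_
  rw [kernelZero_eq hΘ, sub_sub_cancel]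
  refine Submodule.orthogonal_le (inf_le_right : modelSpace Θ ≤ (thetaHardy Θ)ᗮ) ?_
  exact Submodule.le_orthogonal_orthogonal _
    ((mem_thetaHardy hΘ).2 ⟨_, const_mem_hardy _, rfl⟩)

/-- `(S_Θ* f)(z) = (f(z) - f(0)) / z`. -/
theorem adjoint_modelOp (hΘ : IsInner Θ) (f : modelSpace Θ) :
    ((modelOp Θ).adjoint f : L2 E)
      = mulZ (-1) ((f : L2 E) - constL2 (fourierCoeff (f : L2 E) 0)) := by
  set h : L2 E := mulZ (-1) ((f : L2 E) - constL2 (fourierCoeff (f : L2 E) 0)) with hh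
  have hmem : h ∈ modelSpace Θ := by
    constructor
    · intro n hn
      rw [hh, coeff_mulZ, ← coeffL_apply, map_sub, coeffL_apply, coeffL_apply, coeff_const]
      split_ifs with h0
      · rw [h0, sub_self]
      · rw [f.2.1 _ (by omega), sub_zero]
    · rw [SetLike.mem_coe, Submodule.mem_orthogonal]
      intro g hg
      obtain ⟨k, hk, rfl⟩ := (mem_thetaHardy hΘ).1 hg
      rw [hh, ← inner_mulZ_left, ← thetaMul_mulZ, inner_sub_right]
      have h1 : ⟪thetaMul hΘ (mulZ 1 k), (f : L2 E)⟫_ℂ = 0 :=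
        (Submodule.mem_orthogonal _ _).1 f.2.2 _
          ((mem_thetaHardy hΘ).2 ⟨_, mulZ_mem_hardy hk, rfl⟩)
      rw [h1, ← inner_conj_symm, inner_constL2, thetaMul_mulZ, coeff_mulZ,
        thetaMul_mem_hardy hΘ hk _ (by omega)]
      simp
  have : (modelOp Θ).adjoint f = ⟨h, hmem⟩ := by
    apply ext_inner_left ℂ
    intro g
    rw [ContinuousLinearMap.adjoint_inner_right]
    have h1 : ⟪modelOp Θ g, f⟫_ℂ = ⟪mulZ 1 (g : L2 E), (f : L2 E)⟫_ℂ :=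
      Submodule.inner_orthogonalProjectionOnto_eq_of_mem_right f (mulZ 1 (g : L2 E))
    have h2 : ⟪g, (⟨h, hmem⟩ : modelSpace Θ)⟫_ℂ = ⟪(g : L2 E), h⟫_ℂ := rfl
    rw [h1, h2, hh, ← inner_mulZ_left, inner_sub_right]
    have h3 : ⟪mulZ 1 (g : L2 E), (constL2 (fourierCoeff (f : L2 E) 0) : L2 E)⟫_ℂ = 0 := by
      rw [← inner_conj_symm, inner_constL2, coeff_mulZ, g.2.1 _ (by omega)]
      simp
    rw [h3, sub_zero]
  rw [this]

/-- `(I - S_Θ S_Θ*) f = (I - Θ(z) Θ(0)*) f(0)`. -/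
theorem defectOp_apply (hΘ : IsInner Θ) (f : modelSpace Θ) :
    (defectOp Θ f : L2 E) = kernelZero Θ (discValue (f : L2 E) 0) := by
  rw [← projModel_const hΘ, discValue_zero]
  have h : modelOp Θ ((modelOp Θ).adjoint f)
      = f - projModel Θ (constL2 (fourierCoeff (f : L2 E) 0)) := by
    change projModel Θ (mulZ 1 ((modelOp Θ).adjoint f : L2 E)) = _
    rw [adjoint_modelOp hΘ, mulZ_mulZ, add_neg_cancel, mulZ_zero, map_sub]
    congr 1
    exact Submodule.orthogonalProjectionOnto_mem_subspace_eq_self f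
  change ((f - modelOp Θ ((modelOp Θ).adjoint f) : modelSpace Θ) : L2 E) = _
  rw [h, sub_sub_cancel]

theorem defectOp_mem (hΘ : IsInner Θ) (f : modelSpace Θ) : defectOp Θ f ∈ defectSpace Θ :=
  ⟨_, defectOp_apply hΘ f⟩

/-- `I - S_Θ S_Θ*`, regarded as an operator from `K_Θ` to the defect space `D`. -/
def defectMap (hΘ : IsInner Θ) : modelSpace Θ →L[ℂ] defectSpace Θ :=
  (defectOp Θ).codRestrict (defectSpace Θ) (defectOp_mem hΘ)

/-- The map `x ↦ (I - Θ(z) Θ(0)*) x` from `E` to the defect space. -/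
def toDefect (hΘ : IsInner Θ) : E →ₗ[ℂ] defectSpace Θ where
  toFun x := ⟨⟨kernelZero Θ x, kernelZero_mem hΘ x⟩, x, rfl⟩
  map_add' x y := by
    apply Subtype.ext; apply Subtype.ext
    change kernelZero Θ (x + y) = kernelZero Θ x + kernelZero Θ y
    simp only [kernelZero, map_add]; abel
  map_smul' c x := by
    apply Subtype.ext; apply Subtype.ext
    change kernelZero Θ (c • x) = c • kernelZero Θ x
    simp only [kernelZero, map_smul, smul_sub]

theorem toDefect_bijective (hΘ : IsInner Θ) (hp : IsPure Θ) :
    Function.Bijective (toDefect hΘ) := by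
  constructor
  · rw [injective_iff_map_eq_zero]
    intro x hx
    have h0 : kernelZero Θ x = 0 := by
      have h := congrArg (fun d : defectSpace Θ => ((d : modelSpace Θ) : L2 E)) hx
      exact h
    have h1 : coeffL 0 (kernelZero Θ x) = 0 := by rw [h0, map_zero]
    rw [kernelZero_eq hΘ, map_sub, coeffL_apply, coeffL_apply, coeff_const, if_pos rfl,
      coeff_thetaMul_const, ← discValue_zero, sub_eq_zero] at h1
    by_contra hne
    have hpos : 0 < ‖x‖ := norm_pos_iff.2 hne
    have hp' : ‖discValue Θ 0‖ < 1 := hp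
    have h2 : ‖x‖ ≤ ‖discValue Θ 0‖ * (‖discValue Θ 0‖ * ‖x‖) := by
      calc ‖x‖ = ‖discValue Θ 0 ((discValue Θ 0).adjoint x)‖ := by rw [← h1]
        _ ≤ ‖discValue Θ 0‖ * ‖(discValue Θ 0).adjoint x‖ := ContinuousLinearMap.le_opNorm _ _
        _ ≤ _ := by
          gcongr
          refine (ContinuousLinearMap.le_opNorm _ _).trans (le_of_eq ?_)
          rw [LinearIsometryEquiv.norm_map]
    have h3 : ‖discValue Θ 0‖ * ‖x‖ < ‖x‖ := mul_lt_of_lt_one_left hpos hp'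
    have h4 : ‖discValue Θ 0‖ * (‖discValue Θ 0‖ * ‖x‖) ≤ ‖discValue Θ 0‖ * ‖x‖ := by
      gcongr
    linarith
  · rintro ⟨f, x, hx⟩
    exact ⟨x, Subtype.ext (Subtype.ext hx.symm)⟩

/-- The operator `Ω : D → E`, `Ω ((I - Θ(z) Θ(0)*) x) = x`. -/
def omega (hΘ : IsInner Θ) (hp : IsPure Θ) : defectSpace Θ →L[ℂ] E :=
  haveI : FiniteDimensional ℂ (defectSpace Θ) :=
    (LinearEquiv.ofBijective _ (toDefect_bijective hΘ hp)).finiteDimensional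
  LinearMap.toContinuousLinearMap
    (LinearEquiv.ofBijective _ (toDefect_bijective hΘ hp)).symm.toLinearMap

/-- `Ω (I - S_Θ S_Θ*) f = (I - S S*) f`, the constant function `f(0)`. -/
theorem omega_defectMap (hΘ : IsInner Θ) (hp : IsPure Θ) (f : modelSpace Θ) :
    omega hΘ hp (defectMap hΘ f) = discValue (f : L2 E) 0 := by
  have h : defectMap hΘ f = toDefect hΘ (discValue (f : L2 E) 0) :=
    Subtype.ext (Subtype.ext (defectOp_apply hΘ f))
  rw [h]
  exact LinearEquiv.ofBijective_symm_apply_apply (toDefect hΘ) (h := toDefect_bijective hΘ hp) _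

/-- The operator `P_Θ M_Φ Ω : D → K_Θ`, where `Ω` takes values in the constant functions. -/
def symbolOp (hΘ : IsInner Θ) (hp : IsPure Θ) (Φ : L2 (E →L[ℂ] E)) :
    defectSpace Θ →L[ℂ] modelSpace Θ :=
  projModel Θ ∘L mulOp Φ ∘L Lp.constL ∞ circMeasure ℂ ∘L omega hΘ hp

instance completeSpace_defectSpace : CompleteSpace (defectSpace Θ) := by
  have : FiniteDimensional ℂ (defectSpace Θ) := by
    let L : E →ₗ[ℂ] L2 E :=
      { toFun := kernelZero Θ
        map_add' := fun x y => by simp only [kernelZero, map_add]; abel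
        map_smul' := fun c x => by simp only [kernelZero, map_smul, smul_sub, RingHom.id_apply] }
    have hle : (defectSpace Θ).map (modelSpace Θ).subtype ≤ LinearMap.range L := by
      rintro _ ⟨f, ⟨x, hx⟩, rfl⟩
      exact ⟨x, hx.symm⟩
    have := Submodule.finiteDimensional_of_le hle
    exact ((defectSpace Θ).equivMapOfInjective _
      (modelSpace Θ).injective_subtype).symm.finiteDimensional
  exact FiniteDimensional.complete ℂ _

/-- The relation `A - S_Θ A S_Θ* = B (I - S_Θ S_Θ*) + (I - S_Θ S_Θ*) B'*`. In the second summand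
`B'* : K_Θ → D` is the adjoint of `B' : D → K_Θ`, followed by `I - S_Θ S_Θ*` on `D ⊆ K_Θ`. -/
def DefectRelation (hΘ : IsInner Θ) (A : modelSpace Θ →L[ℂ] modelSpace Θ)
    (B B' : defectSpace Θ →L[ℂ] modelSpace Θ) : Prop :=
  A - modelOp Θ ∘L A ∘L (modelOp Θ).adjoint =
    B ∘L defectMap hΘ + defectOp Θ ∘L (defectSpace Θ).subtypeL ∘L
      ContinuousLinearMap.adjoint (𝕜 := ℂ) (E := defectSpace Θ) (F := modelSpace Θ) B'

end Theta

end Inner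

end MTTO

end

/-! Everything is tested on pairs of bounded functions in `modelSpace Θ`. There, for f, g bounded
and Φ in L², both Φf and Φ*g lie in L², so Φ may be moved across the inner product. Such functions
are total (`eq_zero_of_inner_bounded`), so the forms determine the bounded operators.

From symbol to relation: S_Θ* is the backward shift z⁻¹(f - f(0)). If Φ is analytic, Φ(f - f(0))
vanishes at 0 and is orthogonal to constants, whence ⟨Φ S*f, S*g⟩ = ⟨Φf, g⟩ - ⟨Φ f(0), g⟩
(`inner_shift_mulOp`). Subtracting the form of A at (S*f, S*g) from that at (f, g) therefore leaves
⟨Φ f(0), g⟩ + ⟨f, Φ' g(0)⟩, which is the form of the right side of the relation, because Ω(I - SS*)f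
= f(0).

From relation to symbol: purity makes the parametrization of D by E bijective, so B is determined by
the vectors Φx = B((I - ΘΘ(0)*)x). These lie in K_Θ, so they are the columns of an analytic Φ with B
= P_Θ M_Φ Ω (`exists_symbolOp_eq`). Apply the relation at (S*ⁿf, S*ⁿg) and sum over n. The left side
telescopes to ⟨Af, g⟩, since S*ⁿ tends strongly to 0. The right side is ⟨zⁿfₙ, Φ*g⟩ + ⟨Φ'*f, zⁿgₙ⟩,
with fₙ, gₙ the Fourier coefficients, and sums to ⟨f, Φ*g⟩ + ⟨Φ'*f, g⟩.

Finally, an arbitrary L² symbol splits as Φ + Φ'* with both terms analytic (`exists_eq_add_star`),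
which gives the characterization. -/

noncomputable section

namespace MTTO

/-! ### Operator valued functions and their columns -/

section Columns

variable {E : Type*} [NormedAddCommGroup E] [InnerProductSpace ℂ E]

/-- The function `Φ x`, for an operator valued function `Φ` and a vector `x`. -/
def column (x : E) : L2 (E →L[ℂ] E) →L[ℂ] L2 E :=
  (ContinuousLinearMap.apply ℂ E x).compLpL 2 circMeasure

theorem coeFn_column (x : E) (Φ : L2 (E →L[ℂ] E)) :
    column x Φ =ᵐ[circMeasure] fun t => Φ t x :=
  ContinuousLinearMap.coeFn_compLpL _ _

variable [CompleteSpace E]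

theorem coeff_column (x : E) (Φ : L2 (E →L[ℂ] E)) (n : ℤ) :
    fourierCoeff (column x Φ) n = fourierCoeff Φ n x := by
  rw [fourierCoeff_congr_ae (coeFn_column x Φ), fourierCoeff, fourierCoeff,
    ContinuousLinearMap.integral_apply ((integrable_L2 Φ).fourier_smul _)]
  rfl

theorem mem_hardy_iff_column {Φ : L2 (E →L[ℂ] E)} :
    Φ ∈ hardy (E →L[ℂ] E) ↔ ∀ x, column x Φ ∈ hardy E := by
  constructor
  · intro h x n hn
    rw [coeff_column, h n hn]; rfl
  · intro h n hn
    ext x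
    rw [← coeff_column, h x n hn]; rfl

theorem mulOp_constL (Φ : L2 (E →L[ℂ] E)) (x : E) :
    mulOp Φ (Lp.constL ∞ circMeasure ℂ x) = column x Φ := by
  apply Lp.ext
  have h : (Lp.constL ∞ circMeasure ℂ x : LInf E) =ᵐ[circMeasure] fun _ => x :=
    Lp.coeFn_const ..
  filter_upwards [coeFn_mulOp Φ (Lp.constL ∞ circMeasure ℂ x), coeFn_column x Φ, h] with t h1 h2 h3
  rw [h1, h2, h3]

theorem coeff_star (Φ : L2 (E →L[ℂ] E)) (n : ℤ) :
    fourierCoeff (star Φ : L2 (E →L[ℂ] E)) n = star (fourierCoeff Φ (-n)) := by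
  rw [fourierCoeff_congr_ae (Lp.coeFn_star Φ), fourierCoeff, fourierCoeff]
  have h := (starL' ℝ : (E →L[ℂ] E) ≃L[ℝ] (E →L[ℂ] E)).integral_comp_comm
    (μ := circMeasure) (fun t => fourier (-(-n)) t • Φ t)
  change _ = (starL' ℝ : (E →L[ℂ] E) ≃L[ℝ] (E →L[ℂ] E)) _
  rw [← h]
  refine integral_congr_ae (Filter.Eventually.of_forall fun t => ?_)
  simp [star_smul]

variable [FiniteDimensional ℂ E]

/-- The operator valued function with prescribed columns. -/
def ofColumns (L : E →ₗ[ℂ] L2 E) : L2 (E →L[ℂ] E) :=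
  ∑ i, (ContinuousLinearMap.smulRightL ℂ E E
    (innerSL ℂ (stdOrthonormalBasis ℂ E i))).compLpL 2 circMeasure (L (stdOrthonormalBasis ℂ E i))

theorem column_ofColumns (L : E →ₗ[ℂ] L2 E) (x : E) : column x (ofColumns L) = L x := by
  have h : ∀ (y : E) (f : L2 E), column x ((ContinuousLinearMap.smulRightL ℂ E E
      (innerSL ℂ y)).compLpL 2 circMeasure f) = ⟪y, x⟫_ℂ • f := by
    intro y f
    apply Lp.ext
    have h1 := ContinuousLinearMap.coeFn_compLpL (p := 2) (μ := circMeasure)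
      (ContinuousLinearMap.smulRightL ℂ E E (innerSL ℂ y)) f
    filter_upwards [coeFn_column x ((ContinuousLinearMap.smulRightL ℂ E E
      (innerSL ℂ y)).compLpL 2 circMeasure f), h1, Lp.coeFn_smul (⟪y, x⟫_ℂ) f] with t h1 h2 h3
    rw [h1, h2, h3]
    simp
  rw [ofColumns, map_sum]
  simp only [h, ← map_smul]
  rw [← map_sum, OrthonormalBasis.sum_repr']

end Columns

/-! ### Multiplication on bounded functions and the shift identity -/

section Bounded

variable {E : Type*} [NormedAddCommGroup E] [InnerProductSpace ℂ E]

theorem memLp_top_const (x : E) : MemLp (constL2 x : L2 E) ∞ circMeasure := by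
  have h : (constL2 x : L2 E) =ᵐ[circMeasure] fun _ => x := Lp.coeFn_const ..
  exact (memLp_congr_ae h).2 (memLp_const x)

theorem memLp_top_mulZ (n : ℤ) {f : L2 E} (hf : MemLp f ∞ circMeasure) :
    MemLp (mulZ n f) ∞ circMeasure := by
  refine hf.congr_norm (Lp.aestronglyMeasurable _) ?_
  filter_upwards [coeFn_mulZ n f] with t h
  rw [h, norm_smul, fourier_apply, Circle.norm_coe, one_mul]

omit [InnerProductSpace ℂ E] in
theorem memLp_top_sub {f g : L2 E} (hf : MemLp f ∞ circMeasure) (hg : MemLp g ∞ circMeasure) :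
    MemLp (f - g : L2 E) ∞ circMeasure :=
  (memLp_congr_ae (Lp.coeFn_sub f g)).2 (hf.sub hg)

variable [CompleteSpace E]

theorem coeFn_mulOp_toLp (Φ : L2 (E →L[ℂ] E)) {f : L2 E} (hf : MemLp f ∞ circMeasure) :
    mulOp Φ hf.toLp =ᵐ[circMeasure] fun t => Φ t (f t) := by
  filter_upwards [coeFn_mulOp Φ hf.toLp, hf.coeFn_toLp] with t h1 h2
  rw [h1, h2]

theorem mulOp_add_symbol (Φ Ψ : L2 (E →L[ℂ] E)) (f : LInf E) :
    mulOp (Φ + Ψ) f = mulOp Φ f + mulOp Ψ f := by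
  simp [mulOp]

theorem mulOp_mulZ (Φ : L2 (E →L[ℂ] E)) (n : ℤ) {f : L2 E} (hf : MemLp f ∞ circMeasure) :
    mulOp Φ (memLp_top_mulZ n hf).toLp = mulZ n (mulOp Φ hf.toLp) := by
  apply Lp.ext
  filter_upwards [coeFn_mulOp_toLp Φ (memLp_top_mulZ n hf), coeFn_mulOp_toLp Φ hf,
    coeFn_mulZ n f, coeFn_mulZ n (mulOp Φ hf.toLp)] with t h1 h2 h3 h4
  rw [h1, h3, h4, h2, map_smul]

theorem mulOp_sub_toLp (Φ : L2 (E →L[ℂ] E)) {f g : L2 E} (hf : MemLp f ∞ circMeasure)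
    (hg : MemLp g ∞ circMeasure) :
    mulOp Φ (memLp_top_sub hf hg).toLp = mulOp Φ hf.toLp - mulOp Φ hg.toLp := by
  rw [← map_sub]
  congr 1
  apply Lp.ext
  filter_upwards [(memLp_top_sub hf hg).coeFn_toLp, Lp.coeFn_sub hf.toLp hg.toLp,
    hf.coeFn_toLp, hg.coeFn_toLp, Lp.coeFn_sub f g] with t h1 h2 h3 h4 h5
  rw [h1, h2, h5, Pi.sub_apply, Pi.sub_apply, h3, h4]

theorem mulOp_const (Φ : L2 (E →L[ℂ] E)) (x : E) :
    mulOp Φ (memLp_top_const x).toLp = column x Φ := by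
  apply Lp.ext
  have h : (constL2 x : L2 E) =ᵐ[circMeasure] fun _ => x := Lp.coeFn_const ..
  filter_upwards [coeFn_mulOp_toLp Φ (memLp_top_const x), coeFn_column x Φ, h] with t h1 h2 h3
  rw [h1, h2, h3]

/-- A pointwise adjoint under the integral. Both functions must be bounded for both products with
the unbounded Φ to lie in L². -/
theorem inner_mulOp_left (Φ : L2 (E →L[ℂ] E)) {f g : L2 E} (hf : MemLp f ∞ circMeasure)
    (hg : MemLp g ∞ circMeasure) :
    ⟪mulOp Φ hf.toLp, g⟫_ℂ = ⟪f, mulOp (star Φ) hg.toLp⟫_ℂ := by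
  rw [L2.inner_def, L2.inner_def]
  refine integral_congr_ae ?_
  filter_upwards [coeFn_mulOp_toLp Φ hf, coeFn_mulOp_toLp (star Φ) hg, Lp.coeFn_star Φ]
    with t h1 h2 h3
  rw [h1, h2, h3]
  change _ = ⟪f t, (Φ t).adjoint (g t)⟫_ℂ
  rw [ContinuousLinearMap.adjoint_inner_right]

theorem inner_mulOp_star_left (Φ : L2 (E →L[ℂ] E)) {f g : L2 E} (hf : MemLp f ∞ circMeasure)
    (hg : MemLp g ∞ circMeasure) :
    ⟪mulOp (star Φ) hf.toLp, g⟫_ℂ = ⟪f, mulOp Φ hg.toLp⟫_ℂ := by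
  rw [inner_mulOp_left (star Φ) hf hg, star_star]

variable [FiniteDimensional ℂ E]

/-- For analytic `Φ` and a bounded analytic `f` with `f(0) = 0`, the product `Φ f` vanishes
at `0`. -/
theorem inner_const_mulOp_eq_zero {Φ : L2 (E →L[ℂ] E)} (hΦ : Φ ∈ hardy (E →L[ℂ] E))
    {f : L2 E} (hf : MemLp f ∞ circMeasure) (hf' : mulZ (-1) f ∈ hardy E) (x : E) :
    ⟪(constL2 x : L2 E), mulOp Φ hf.toLp⟫_ℂ = 0 := by
  -- With Φ moved onto the constant, the expression becomes an L²-continuous functional of z⁻¹f in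
  -- H². It therefore suffices to check it on the monomials zⁿy, where it picks out a negative
  -- coefficient of Φy.
  rw [← inner_mulOp_star_left Φ (memLp_top_const x) hf, ← mulZ_zero f, ← add_neg_cancel 1,
    ← mulZ_mulZ, ← neg_neg (1 : ℤ), ← inner_mulZ_left, neg_neg]
  set L := innerSL ℂ (mulZ (-1) (mulOp (star Φ) (memLp_top_const x).toLp)) with hL
  have : mulZ (-1) f ∈ L.ker := by
    refine hardy_le L.ker L.isClosed_ker (fun n y => ?_) hf'
    change ⟪mulZ (-1) (mulOp (star Φ) (memLp_top_const x).toLp), mulZ n (constL2 y)⟫_ℂ = 0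
    rw [inner_mulZ_left, neg_neg, mulZ_mulZ, inner_mulOp_star_left Φ _
      (memLp_top_mulZ _ (memLp_top_const y)),
      mulOp_mulZ Φ _ (memLp_top_const y), inner_constL2, coeff_mulZ, mulOp_const,
      coeff_column, hΦ _ (by omega)]
    simp
  exact this

omit [FiniteDimensional ℂ E] in
theorem mulZ_neg_sub_const_mem_hardy {f : L2 E} (hf : f ∈ hardy E) :
    mulZ (-1) (f - constL2 (fourierCoeff f 0)) ∈ hardy E := by
  intro n hn
  rw [coeff_mulZ, ← coeffL_apply, map_sub, coeffL_apply, coeffL_apply, coeff_const]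
  split_ifs with h0
  · rw [h0, sub_self]
  · rw [hf _ (by omega), sub_zero]

/-- The factors z⁻¹ on the two sides cancel, and Φ(f - f(0)) is orthogonal to the constant g(0);
only the term with Φ f(0) is lost. -/
theorem inner_shift_mulOp {Φ : L2 (E →L[ℂ] E)} (hΦ : Φ ∈ hardy (E →L[ℂ] E)) {f g f' g' : L2 E}
    (hf : f ∈ hardy E) (hfb : MemLp f ∞ circMeasure)
    (hf' : f' = mulZ (-1) (f - constL2 (fourierCoeff f 0)))
    (hg' : g' = mulZ (-1) (g - constL2 (fourierCoeff g 0))) (hfb' : MemLp f' ∞ circMeasure) :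
    ⟪g', mulOp Φ hfb'.toLp⟫_ℂ
      = ⟪g, mulOp Φ hfb.toLp⟫_ℂ - ⟪g, column (fourierCoeff f 0) Φ⟫_ℂ := by
  subst hf' hg'
  have hw := memLp_top_sub hfb (memLp_top_const (fourierCoeff f 0))
  rw [mulOp_mulZ Φ (-1) hw, inner_mulZ_left, mulZ_mulZ, neg_neg, add_neg_cancel, mulZ_zero,
    inner_sub_left, inner_const_mulOp_eq_zero hΦ hw (mulZ_neg_sub_const_mem_hardy hf), sub_zero,
    mulOp_sub_toLp Φ hfb (memLp_top_const _), inner_sub_right, mulOp_const]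

theorem inner_shift_mulOp_left {Φ : L2 (E →L[ℂ] E)} (hΦ : Φ ∈ hardy (E →L[ℂ] E))
    {f g f' g' : L2 E} (hf : f ∈ hardy E) (hfb : MemLp f ∞ circMeasure)
    (hf' : f' = mulZ (-1) (f - constL2 (fourierCoeff f 0)))
    (hg' : g' = mulZ (-1) (g - constL2 (fourierCoeff g 0))) (hfb' : MemLp f' ∞ circMeasure) :
    ⟪mulOp Φ hfb'.toLp, g'⟫_ℂ
      = ⟪mulOp Φ hfb.toLp, g⟫_ℂ - ⟪column (fourierCoeff f 0) Φ, g⟫_ℂ := by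
  rw [← inner_conj_symm, inner_shift_mulOp hΦ hf hfb hf' hg', map_sub, inner_conj_symm,
    inner_conj_symm]

end Bounded

/-! ### Partial sums of Fourier series in the Hardy space -/

section Truncation

variable {E : Type*} [NormedAddCommGroup E] [InnerProductSpace ℂ E]

/-- The partial sum `∑_{k < n} z^k f_k` of the Fourier series of `f`. -/
def trunc (n : ℕ) : L2 E →L[ℂ] L2 E :=
  ∑ k ∈ Finset.range n, mulZ k ∘L constL2 ∘L coeffL (k : ℤ)

theorem trunc_zero (f : L2 E) : trunc 0 f = 0 := by simp [trunc]

theorem trunc_succ (n : ℕ) (f : L2 E) :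
    trunc (n + 1) f = trunc n f + mulZ n (constL2 (fourierCoeff f n)) := by
  simp [trunc, Finset.sum_range_succ]

variable [CompleteSpace E]

theorem coeff_trunc (n : ℕ) (f : L2 E) (k : ℤ) :
    fourierCoeff (trunc n f) k = if 0 ≤ k ∧ k < n then fourierCoeff f k else 0 := by
  induction n with
  | zero => rw [trunc_zero, ← coeffL_apply, map_zero, if_neg (by omega)]
  | succ n ih =>
    rw [trunc_succ, ← coeffL_apply, map_add, coeffL_apply, coeffL_apply, ih, coeff_mulZ,
      coeff_const]
    rcases lt_trichotomy k n with h | h | h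
    · rw [if_neg (show ¬ k - n = 0 by omega), add_zero]
      congr 1
      apply propext
      constructor <;> intro h' <;> constructor <;> (push_cast at *; omega)
    · subst h; simp
    · rw [if_neg (by omega), if_neg (by omega), if_neg (by push_cast; omega), add_zero]

theorem inner_trunc_sub (n : ℕ) (f : L2 E) : ⟪trunc n f, f - trunc n f⟫_ℂ = 0 := by
  have h : ∀ m ≤ n, ⟪trunc m f, f - trunc n f⟫_ℂ = 0 := by
    intro m
    induction m with
    | zero => intro _; rw [trunc_zero, inner_zero_left]
    | succ m ih =>
      intro hm
      rw [trunc_succ, inner_add_left, ih (by omega), inner_mulZ_const,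
        ← coeffL_apply (m : ℤ) (f - trunc n f), map_sub,
        coeffL_apply, coeffL_apply, coeff_trunc, if_pos (by omega), sub_self, inner_zero_right,
        add_zero]
  exact h n le_rfl

theorem norm_sub_trunc_le (n : ℕ) (f : L2 E) : ‖f - trunc n f‖ ≤ ‖f‖ := by
  have h := norm_add_sq_eq_norm_sq_add_norm_sq_of_inner_eq_zero _ _ (inner_trunc_sub n f)
  rw [add_sub_cancel] at h
  nlinarith [norm_nonneg f, norm_nonneg (f - trunc n f), norm_nonneg (trunc n f)]

variable [FiniteDimensional ℂ E]

open Filter Topology in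
/-- The Fourier series of an element of the Hardy space converges to it. -/
theorem tendsto_trunc {f : L2 E} (hf : f ∈ hardy E) :
    Tendsto (fun n => trunc n f) atTop (𝓝 f) := by
  let V : Submodule ℂ (L2 E) :=
    { carrier := {f | Tendsto (fun n => trunc n f) atTop (𝓝 f)}
      add_mem' := fun {f g} hf hg => by
        simp only [Set.mem_ofPred_eq, map_add]; exact Tendsto.add hf hg
      zero_mem' := by simp
      smul_mem' := fun c f hf => by
        simp only [Set.mem_ofPred_eq, map_smul]; exact Tendsto.const_smul hf c }
  refine hardy_le V ?_ (fun n x => ?_) hf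
  -- The set of convergence is closed because I - `trunc n` is a contraction for every n.
  · refine isClosed_of_closure_subset fun f hf => ?_
    change Tendsto (fun n => trunc n f) atTop (𝓝 f)
    rw [Metric.tendsto_atTop]
    intro ε hε
    obtain ⟨g, hg, hfg⟩ := Metric.mem_closure_iff.1 hf (ε / 2) (half_pos hε)
    obtain ⟨N, hN⟩ := Metric.tendsto_atTop.1 (show Tendsto _ _ _ from hg) (ε / 2) (half_pos hε)
    refine ⟨N, fun n hn => ?_⟩
    have h1 := hN n hn
    rw [dist_comm, dist_eq_norm] at h1 ⊢
    rw [dist_eq_norm] at hfg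
    calc ‖f - trunc n f‖ = ‖(f - g - trunc n (f - g)) + (g - trunc n g)‖ := by
          rw [map_sub]; congr 1; abel
      _ ≤ ‖f - g - trunc n (f - g)‖ + ‖g - trunc n g‖ := norm_add_le _ _
      _ < ε := by linarith [norm_sub_trunc_le n (f - g)]
  -- On a monomial of degree n the partial sums are constant once m > n.
  · refine tendsto_const_nhds.congr' ?_
    filter_upwards [eventually_gt_atTop n] with m hm
    refine (sub_eq_zero.1 (eq_zero_of_coeff _ fun k => ?_)).symm
    rw [← coeffL_apply, map_sub, coeffL_apply, coeffL_apply, coeff_trunc, coeff_mulZ, coeff_const]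
    by_cases hk : k - n = 0
    · rw [if_pos hk, if_pos (by omega), sub_self]
    · rw [if_neg hk]; simp

omit [FiniteDimensional ℂ E] in
theorem norm_mulZ (n : ℤ) (f : L2 E) : ‖mulZ n f‖ = ‖f‖ := by
  rw [@norm_eq_sqrt_re_inner ℂ, @norm_eq_sqrt_re_inner ℂ, inner_mulZ_left, mulZ_mulZ,
    neg_add_cancel, mulZ_zero]

end Truncation

variable {E : Type*} [NormedAddCommGroup E] [InnerProductSpace ℂ E] [CompleteSpace E]
  [FiniteDimensional ℂ E] {Θ : L2 (E →L[ℂ] E)}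

/-! ### Totality of the bounded functions in the model space -/

section BoundedModel

theorem memLp_top_thetaMul_const (hΘ : IsInner Θ) (x : E) :
    MemLp (thetaMul hΘ (constL2 x)) ∞ circMeasure := by
  refine (memLp_top_const x).congr_norm (Lp.aestronglyMeasurable _) ?_
  filter_upwards [coeFn_thetaMul hΘ (constL2 x), hΘ.unitary] with t h1 h2
  rw [h1, ContinuousLinearMap.norm_map_of_mem_unitary h2]

theorem inner_thetaMul_of_mem (hΘ : IsInner Θ) {f g : L2 E} (hf : f ∈ modelSpace Θ)
    (hg : g ∈ hardy E) : ⟪f, thetaMul hΘ g⟫_ℂ = 0 :=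
  (Submodule.mem_orthogonal' _ _).1 hf.2 _ ((mem_thetaHardy hΘ).2 ⟨g, hg, rfl⟩)

/-- Since f is orthogonal to ΘH², zf is orthogonal to zΘH²; only the constants Θc remain to be
removed. -/
theorem exists_mulZ_sub_thetaMul_const_mem (hΘ : IsInner Θ) {f : L2 E} (hf : f ∈ modelSpace Θ) :
    ∃ c : E, mulZ 1 f - thetaMul hΘ (constL2 c) ∈ modelSpace Θ := by
  -- As Θ acts isometrically, this c makes Θc the orthogonal projection of zf onto the functions Θy,
  -- y in E.
  refine ⟨(thetaMul hΘ ∘L constL2).adjoint (mulZ 1 f),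
    sub_mem (mulZ_mem_hardy hf.1) (thetaMul_mem_hardy hΘ (const_mem_hardy _)), ?_⟩
  rw [SetLike.mem_coe, Submodule.mem_orthogonal']
  intro g hg
  obtain ⟨h, hh, rfl⟩ := (mem_thetaHardy hΘ).1 hg
  have key : ⟪mulZ 1 f, thetaMul hΘ (h - constL2 (fourierCoeff h 0))⟫_ℂ = 0 := by
    rw [inner_mulZ_left, ← thetaMul_mulZ]
    exact inner_thetaMul_of_mem hΘ hf (mulZ_neg_sub_const_mem_hardy hh)
  rw [map_sub, inner_sub_right] at key
  rw [inner_sub_left, thetaMul_inner, inner_constL2, ContinuousLinearMap.adjoint_inner_left]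
  exact key

/-- The function v is P_Θ(zⁿx). It stays bounded along the induction because each step multiplies by
z and subtracts some Θc, which is bounded since Θ is unitary almost everywhere. -/
theorem exists_bounded_sub_mem_thetaHardy (hΘ : IsInner Θ) (n : ℕ) (x : E) :
    ∃ v ∈ modelSpace Θ, MemLp v ∞ circMeasure ∧ mulZ n (constL2 x) - v ∈ thetaHardy Θ := by
  induction n with
  | zero =>
    refine ⟨kernelZero Θ x, kernelZero_mem hΘ x, ?_, ?_⟩
    · rw [kernelZero_eq hΘ]
      exact memLp_top_sub (memLp_top_const x) (memLp_top_thetaMul_const hΘ _)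
    · rw [Nat.cast_zero, mulZ_zero, kernelZero_eq hΘ, sub_sub_cancel]
      exact (mem_thetaHardy hΘ).2 ⟨_, const_mem_hardy _, rfl⟩
  | succ n ih =>
    obtain ⟨v, hv, hb, hd⟩ := ih
    obtain ⟨h, hh, hd⟩ := (mem_thetaHardy hΘ).1 hd
    obtain ⟨c, hc⟩ := exists_mulZ_sub_thetaMul_const_mem hΘ hv
    refine ⟨_, hc, memLp_top_sub (memLp_top_mulZ 1 hb) (memLp_top_thetaMul_const hΘ _),
      (mem_thetaHardy hΘ).2 ⟨mulZ 1 h + constL2 c,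
        add_mem (mulZ_mem_hardy hh) (const_mem_hardy c), ?_⟩⟩
    rw [map_add, thetaMul_mulZ, hd, map_sub, mulZ_mulZ, Nat.cast_succ, add_comm (1 : ℤ)]
    abel

/-- The bounded functions in the model space are total. -/
theorem eq_zero_of_inner_bounded (hΘ : IsInner Θ) (f : modelSpace Θ)
    (h : ∀ g : modelSpace Θ, MemLp (g : L2 E) ∞ circMeasure → ⟪f, g⟫_ℂ = 0) : f = 0 := by
  apply Subtype.ext
  refine eq_zero_of_coeff _ fun n => ?_
  rcases lt_or_ge n 0 with hn | hn
  · exact f.2.1 n hn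
  lift n to ℕ using hn
  apply ext_inner_left ℂ
  intro x
  -- Modulo ΘH², which f does not see, zⁿx may be replaced by a bounded v in the model space.
  obtain ⟨v, hv, hb, hd⟩ := exists_bounded_sub_mem_thetaHardy hΘ n x
  have h1 : ⟪(f : L2 E), v⟫_ℂ = 0 := h ⟨v, hv⟩ hb
  have h2 : ⟪mulZ n (constL2 x) - v, (f : L2 E)⟫_ℂ = 0 :=
    (Submodule.mem_orthogonal _ _).1 f.2.2 _ hd
  rw [inner_sub_left, ← inner_conj_symm v, h1, map_zero, sub_zero, inner_mulZ_const] at h2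
  rw [h2, inner_zero_right]

theorem eq_of_inner_bounded (hΘ : IsInner Θ) {A A' : modelSpace Θ →L[ℂ] modelSpace Θ}
    (h : ∀ f g : modelSpace Θ, MemLp (f : L2 E) ∞ circMeasure → MemLp (g : L2 E) ∞ circMeasure →
      ⟪A f, g⟫_ℂ = ⟪A' f, g⟫_ℂ) : A = A' := by
  have h1 : ∀ f : modelSpace Θ, MemLp (f : L2 E) ∞ circMeasure → A f = A' f := fun f hf => by
    rw [← sub_eq_zero]
    refine eq_zero_of_inner_bounded hΘ _ fun g hg => ?_
    rw [inner_sub_left, h f g hf hg, sub_self]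
  -- Agreement on bounded vectors extends to all vectors by a second use of totality, now for the
  -- adjoints.
  apply ContinuousLinearMap.adjoint.injective
  ext1 g
  rw [← sub_eq_zero]
  refine eq_zero_of_inner_bounded hΘ _ fun f hf => ?_
  rw [inner_sub_left, ContinuousLinearMap.adjoint_inner_left,
    ContinuousLinearMap.adjoint_inner_left, h1 f hf, sub_self]

end BoundedModel

/-! ### Iterates of the backward shift -/

section Shift

omit [FiniteDimensional ℂ E] in
theorem inner_projModel_left (f : L2 E) (g : modelSpace Θ) :
    ⟪projModel Θ f, g⟫_ℂ = ⟪f, (g : L2 E)⟫_ℂ :=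
  Submodule.inner_orthogonalProjectionOnto_eq_of_mem_right g f

omit [FiniteDimensional ℂ E] in
theorem inner_projModel_right (f : modelSpace Θ) (g : L2 E) :
    ⟪f, projModel Θ g⟫_ℂ = ⟪(f : L2 E), g⟫_ℂ :=
  Submodule.inner_orthogonalProjectionOnto_eq_of_mem_left f g

omit [FiniteDimensional ℂ E] in
theorem projModel_coe (f : modelSpace Θ) : projModel Θ (f : L2 E) = f :=
  Submodule.orthogonalProjectionOnto_mem_subspace_eq_self f

theorem memLp_top_adjoint_modelOp (hΘ : IsInner Θ) {f : modelSpace Θ}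
    (hf : MemLp (f : L2 E) ∞ circMeasure) :
    MemLp ((modelOp Θ).adjoint f : L2 E) ∞ circMeasure := by
  rw [adjoint_modelOp hΘ]
  exact memLp_top_mulZ _ (memLp_top_sub hf (memLp_top_const _))

/-- Each application of S* deletes the constant term and divides by z; the constant term met at
stage n is the n-th coefficient of f. -/
theorem adjoint_modelOp_iterate (hΘ : IsInner Θ) (f : modelSpace Θ) (n : ℕ) :
    (((modelOp Θ).adjoint)^[n] f : L2 E) = mulZ (-n) ((f : L2 E) - trunc n (f : L2 E)) := by
  induction n with
  | zero => simp [trunc_zero, mulZ_zero]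
  | succ n ih =>
    have h0 : fourierCoeff (mulZ (-n) ((f : L2 E) - trunc n (f : L2 E))) 0
        = fourierCoeff (f : L2 E) n := by
      rw [coeff_mulZ, ← coeffL_apply, map_sub, coeffL_apply, coeffL_apply, coeff_trunc,
        if_neg (by omega), sub_zero, zero_sub, neg_neg]
    rw [Function.iterate_succ_apply', adjoint_modelOp hΘ, ih, h0, trunc_succ, ← sub_sub, map_sub,
      map_sub _ _ (mulZ n (constL2 (fourierCoeff (f : L2 E) n))), mulZ_mulZ, mulZ_mulZ]
    congr 2
    · congr 1; push_cast; ring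
    · congr 2; push_cast; ring

theorem coeff_adjoint_modelOp_iterate (hΘ : IsInner Θ) (f : modelSpace Θ) (n : ℕ) :
    fourierCoeff (((modelOp Θ).adjoint)^[n] f : L2 E) 0 = fourierCoeff (f : L2 E) n := by
  rw [adjoint_modelOp_iterate hΘ, coeff_mulZ, ← coeffL_apply, map_sub, coeffL_apply, coeffL_apply,
    coeff_trunc, if_neg (by omega), sub_zero, zero_sub, neg_neg]

open Filter Topology in
-- Multiplication by z⁻ⁿ is isometric, so the norm of S*ⁿf is that of the tail of the Fourier series
-- of f.
theorem tendsto_adjoint_modelOp_iterate (hΘ : IsInner Θ) (f : modelSpace Θ) :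
    Tendsto (fun n => ((modelOp Θ).adjoint)^[n] f) atTop (𝓝 0) := by
  rw [tendsto_zero_iff_norm_tendsto_zero]
  have h : ∀ n, ‖((modelOp Θ).adjoint)^[n] f‖ = ‖(f : L2 E) - trunc n (f : L2 E)‖ := fun n => by
    rw [← norm_mulZ (-n) ((f : L2 E) - _), ← adjoint_modelOp_iterate hΘ]
    rfl
  simp only [h]
  have := (tendsto_const_nhds (x := (f : L2 E))).sub (tendsto_trunc f.2.1)
  rw [sub_self] at this
  exact tendsto_zero_iff_norm_tendsto_zero.1 this

end Shift

/-! ### Sesquilinear forms of the two sides, in an abstract Hilbert space -/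

section HilbertSpace

variable {K : Type*} [NormedAddCommGroup K] [InnerProductSpace ℂ K] [CompleteSpace K]

theorem inner_sub_comp_adjoint (A S : K →L[ℂ] K) (f g : K) :
    ⟪(A - S ∘L A ∘L S.adjoint) f, g⟫_ℂ = ⟪A f, g⟫_ℂ - ⟪A (S.adjoint f), S.adjoint g⟫_ℂ := by
  rw [sub_apply, inner_sub_left, ContinuousLinearMap.adjoint_inner_right]
  rfl

theorem inner_id_sub_comp_adjoint (S : K →L[ℂ] K) (f g : K) :
    ⟪(ContinuousLinearMap.id ℂ K - S ∘L S.adjoint) f, g⟫_ℂ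
      = ⟪f, (ContinuousLinearMap.id ℂ K - S ∘L S.adjoint) g⟫_ℂ := by
  rw [sub_apply, sub_apply, inner_sub_left, inner_sub_right, ContinuousLinearMap.comp_apply,
    ContinuousLinearMap.comp_apply, ← ContinuousLinearMap.adjoint_inner_right S,
    ← ContinuousLinearMap.adjoint_inner_left S]
  rfl

theorem isSymmetric_of_eq_id_sub {Q S : K →L[ℂ] K}
    (h : Q = ContinuousLinearMap.id ℂ K - S ∘L S.adjoint) (f g : K) :
    ⟪Q f, g⟫_ℂ = ⟪f, Q g⟫_ℂ := by
  rw [h, inner_id_sub_comp_adjoint]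

/-- Here P is the symmetric operator Q with values in M, so ⟨Q B'* f, g⟩ = ⟨B'* f, P g⟩ = ⟨f, B' P
g⟩. -/
theorem inner_comp_add_comp_adjoint {M : Submodule ℂ K} [CompleteSpace M] (B B' : M →L[ℂ] K)
    (P : K →L[ℂ] M) (Q : K →L[ℂ] K) (hP : ∀ g, (P g : K) = Q g)
    (hQ : ∀ f g, ⟪Q f, g⟫_ℂ = ⟪f, Q g⟫_ℂ) (f g : K) :
    ⟪(B ∘L P + Q ∘L M.subtypeL ∘L
      ContinuousLinearMap.adjoint (𝕜 := ℂ) (E := M) (F := K) B') f, g⟫_ℂ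
      = ⟪B (P f), g⟫_ℂ + ⟪f, B' (P g)⟫_ℂ := by
  rw [add_apply, inner_add_left, ← ContinuousLinearMap.adjoint_inner_left, Submodule.coe_inner,
    hP, ← hQ]
  rfl

end HilbertSpace

/-! ### Operators on the defect space, and from symbol to relation -/

section Relation

theorem omega_toDefect (hΘ : IsInner Θ) (hp : IsPure Θ) (x : E) :
    omega hΘ hp (toDefect hΘ x) = x :=
  LinearEquiv.ofBijective_symm_apply_apply (toDefect hΘ) (h := toDefect_bijective hΘ hp) x

theorem symbolOp_apply (hΘ : IsInner Θ) (hp : IsPure Θ) (Φ : L2 (E →L[ℂ] E))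
    (d : defectSpace Θ) : symbolOp hΘ hp Φ d = projModel Θ (column (omega hΘ hp d) Φ) := by
  rw [← mulOp_constL]; rfl

/-- Every operator `D → K_Θ` is of the form `P_Θ M_Φ Ω` with `Φ ∈ H²`. -/
theorem exists_symbolOp_eq (hΘ : IsInner Θ) (hp : IsPure Θ)
    (B : defectSpace Θ →L[ℂ] modelSpace Θ) :
    ∃ Φ ∈ hardy (E →L[ℂ] E), B = symbolOp hΘ hp Φ := by
  -- The columns of Φ are values of B, hence analytic and fixed by P_Θ.
  let L : E →ₗ[ℂ] L2 E := (modelSpace Θ).subtype ∘ₗ B.toLinearMap ∘ₗ toDefect hΘ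
  have hL : ∀ x, L x = (B (toDefect hΘ x) : L2 E) := fun _ => rfl
  refine ⟨ofColumns L, mem_hardy_iff_column.2 fun x => ?_, ?_⟩
  · rw [column_ofColumns, hL]
    exact (B (toDefect hΘ x)).2.1
  · ext1 d
    obtain ⟨x, rfl⟩ := (toDefect_bijective hΘ hp).2 d
    rw [symbolOp_apply, omega_toDefect, column_ofColumns, hL, projModel_coe]

theorem inner_symbolOp_defectMap (hΘ : IsInner Θ) (hp : IsPure Θ) (Φ : L2 (E →L[ℂ] E))
    (f g : modelSpace Θ) :
    ⟪symbolOp hΘ hp Φ (defectMap hΘ f), g⟫_ℂ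
      = ⟪column (fourierCoeff (f : L2 E) 0) Φ, (g : L2 E)⟫_ℂ := by
  rw [symbolOp_apply, omega_defectMap, discValue_zero, inner_projModel_left]

theorem inner_symbolOp_defectMap_right (hΘ : IsInner Θ) (hp : IsPure Θ) (Φ : L2 (E →L[ℂ] E))
    (f g : modelSpace Θ) :
    ⟪f, symbolOp hΘ hp Φ (defectMap hΘ g)⟫_ℂ
      = ⟪(f : L2 E), column (fourierCoeff (g : L2 E) 0) Φ⟫_ℂ := by
  rw [symbolOp_apply, omega_defectMap, discValue_zero, inner_projModel_right]

/-- The sesquilinear form of the right hand side of the defect relation. -/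
theorem inner_defect_rhs (hΘ : IsInner Θ) (hp : IsPure Θ) (Φ Φ' : L2 (E →L[ℂ] E))
    (f g : modelSpace Θ) :
    ⟪(symbolOp hΘ hp Φ ∘L defectMap hΘ + defectOp Θ ∘L (defectSpace Θ).subtypeL ∘L
      ContinuousLinearMap.adjoint (𝕜 := ℂ) (E := defectSpace Θ) (F := modelSpace Θ)
        (symbolOp hΘ hp Φ')) f, g⟫_ℂ
      = ⟪column (fourierCoeff (f : L2 E) 0) Φ, (g : L2 E)⟫_ℂ
        + ⟪(f : L2 E), column (fourierCoeff (g : L2 E) 0) Φ'⟫_ℂ := by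
  have h1 := inner_symbolOp_defectMap hΘ hp Φ f g
  have h2 := inner_symbolOp_defectMap_right hΘ hp Φ' f g
  have h4 := inner_comp_add_comp_adjoint (K := modelSpace Θ) (M := defectSpace Θ)
    (symbolOp hΘ hp Φ) (symbolOp hΘ hp Φ') (defectMap hΘ) (defectOp Θ)
    (ContinuousLinearMap.coe_codRestrict_apply (defectOp Θ) (defectSpace Θ) (defectOp_mem hΘ))
    (isSymmetric_of_eq_id_sub rfl) f g
  exact h4.trans (congrArg₂ (· + ·) h1 h2)

/-- Weak form of the symbol condition, with the coanalytic part moved to the right so that only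
multiplication by Φ and Φ' appears. -/
theorem hasSymbol_iff_inner (hΘ : IsInner Θ) (A : modelSpace Θ →L[ℂ] modelSpace Θ)
    (Φ Φ' : L2 (E →L[ℂ] E)) :
    HasSymbol Θ A (Φ + star Φ') ↔ ∀ (f g : modelSpace Θ) (hf : MemLp (f : L2 E) ∞ circMeasure)
      (hg : MemLp (g : L2 E) ∞ circMeasure),
      ⟪A f, g⟫_ℂ = ⟪mulOp Φ hf.toLp, (g : L2 E)⟫_ℂ + ⟪(f : L2 E), mulOp Φ' hg.toLp⟫_ℂ := by
  constructor
  · intro h f g hf hg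
    rw [h f hf, inner_projModel_left, mulOp_add_symbol, inner_add_left,
      inner_mulOp_star_left Φ' hf hg]
  · intro h f hf
    rw [← sub_eq_zero]
    refine eq_zero_of_inner_bounded hΘ _ fun g hg => ?_
    rw [inner_sub_left, h f g hf hg, inner_projModel_left, mulOp_add_symbol, inner_add_left,
      inner_mulOp_star_left Φ' hf hg, sub_self]

theorem defectRelation_of_hasSymbol (hΘ : IsInner Θ) (hp : IsPure Θ)
    {A : modelSpace Θ →L[ℂ] modelSpace Θ} {Φ Φ' : L2 (E →L[ℂ] E)}
    (hΦ : Φ ∈ hardy (E →L[ℂ] E)) (hΦ' : Φ' ∈ hardy (E →L[ℂ] E))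
    (h : HasSymbol Θ A (Φ + star Φ')) :
    DefectRelation hΘ A (symbolOp hΘ hp Φ) (symbolOp hΘ hp Φ') := by
  rw [hasSymbol_iff_inner hΘ] at h
  refine eq_of_inner_bounded hΘ fun f g hf hg => ?_
  have e1 := inner_sub_comp_adjoint A (modelOp Θ) f g
  have e2 := inner_defect_rhs hΘ hp Φ Φ' f g
  suffices e : _ from e1.trans (Eq.trans e e2.symm)
  clear e1 e2
  have h0 := h f g hf hg
  have h1 := h _ _ (memLp_top_adjoint_modelOp hΘ hf) (memLp_top_adjoint_modelOp hΘ hg)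
  have h2 := inner_shift_mulOp_left hΦ f.2.1 hf (adjoint_modelOp hΘ f)
    (adjoint_modelOp hΘ g) (memLp_top_adjoint_modelOp hΘ hf)
  have h3 := inner_shift_mulOp hΦ' g.2.1 hg (adjoint_modelOp hΘ g)
    (adjoint_modelOp hΘ f) (memLp_top_adjoint_modelOp hΘ hg)
  -- The form of A at (f, g) minus that at (S*f, S*g), with the shift identity applied to Φ and to
  -- Φ'.
  linear_combination h0 - h1 - h2 - h3

end Relation

/-! ### Analytic and coanalytic parts of a symbol -/

section Splitting

/-- Every operator valued `L²` function is the sum of an analytic and a coanalytic one. -/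
theorem exists_eq_add_star (Ψ : L2 (E →L[ℂ] E)) :
    ∃ Φ ∈ hardy (E →L[ℂ] E), ∃ Φ' ∈ hardy (E →L[ℂ] E), Ψ = Φ + star Φ' := by
  have : CompleteSpace (hardy E) := (isClosed_hardy (F := E)).completeSpace_coe
  let L : E →L[ℂ] L2 E :=
    (hardy E).starProjection ∘L mulOp Ψ ∘L Lp.constL ∞ circMeasure ℂ
  have hL : ∀ x, L x = (hardy E).starProjection (column x Ψ) := fun x => by
    rw [← mulOp_constL]; rfl
  -- Φ is the columnwise projection of Ψ onto H², constant term included. The remainder has only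
  -- negative frequencies, which the star makes positive.
  refine ⟨ofColumns L.toLinearMap, mem_hardy_iff_column.2 fun x => ?_,
    star (Ψ - ofColumns L.toLinearMap), fun n hn => ?_, ?_⟩
  · rw [column_ofColumns]
    change L x ∈ hardy E
    rw [hL]
    exact Submodule.starProjection_apply_mem _ _
  · rw [coeff_star, star_eq_zero]
    obtain ⟨m, hm⟩ := Int.eq_ofNat_of_zero_le (show 0 ≤ -n by omega)
    ext x
    apply ext_inner_left ℂ
    intro y
    rw [← coeff_column, map_sub, column_ofColumns, hm, ← inner_mulZ_const]
    change ⟪_, column x Ψ - L x⟫_ℂ = _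
    rw [hL]
    refine ((Submodule.mem_orthogonal _ _).1
      (Submodule.sub_starProjection_mem_orthogonal (column x Ψ)) _
      (mulZ_const_mem_hardy m y)).trans ?_
    simp
  · rw [star_star, add_sub_cancel]

end Splitting

/-! ### Telescoping, and from relation to symbol -/

section Iteration

omit [FiniteDimensional ℂ E] in
theorem inner_mulZ_trunc {f : L2 E} (hf : f ∈ hardy E) (n : ℕ) (g : L2 E) :
    ⟪mulZ n f, trunc n g⟫_ℂ = 0 := by
  have h : ∀ m ≤ n, ⟪mulZ n f, trunc m g⟫_ℂ = 0 := by
    intro m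
    induction m with
    | zero => intro _; rw [trunc_zero, inner_zero_right]
    | succ m ih =>
      intro hm
      rw [trunc_succ, inner_add_right, ih (by omega), ← inner_conj_symm (mulZ n f),
        inner_mulZ_const, coeff_mulZ, hf _ (by omega), inner_zero_right, map_zero, add_zero]
  exact h n le_rfl

/-- The function zⁿΦx has no frequency below n, so it does not see the truncation of g; boundedness
of g then lets Φ cross over. -/
theorem inner_column_mulZ_sub_trunc {Φ : L2 (E →L[ℂ] E)} (hΦ : Φ ∈ hardy (E →L[ℂ] E)) (x : E)
    (n : ℕ) {g : L2 E} (hg : MemLp g ∞ circMeasure) :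
    ⟪column x Φ, mulZ (-n) (g - trunc n g)⟫_ℂ
      = ⟪mulZ n (constL2 x), mulOp (star Φ) hg.toLp⟫_ℂ := by
  rw [← inner_mulZ_left, inner_sub_right, inner_mulZ_trunc (mem_hardy_iff_column.1 hΦ x), sub_zero,
    ← mulOp_const, ← mulOp_mulZ Φ n (memLp_top_const x), inner_mulOp_left Φ _ hg]

theorem inner_mulZ_sub_trunc_column {Φ : L2 (E →L[ℂ] E)} (hΦ : Φ ∈ hardy (E →L[ℂ] E)) (x : E)
    (n : ℕ) {g : L2 E} (hg : MemLp g ∞ circMeasure) :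
    ⟪mulZ (-n) (g - trunc n g), column x Φ⟫_ℂ
      = ⟪mulOp (star Φ) hg.toLp, mulZ n (constL2 x)⟫_ℂ := by
  rw [← inner_conj_symm, inner_column_mulZ_sub_trunc hΦ x n hg, inner_conj_symm]

open Filter Topology in
-- Summing the differences pairs u and w with the partial Fourier sums of f and g, which converge in
-- L².
theorem eq_inner_add_inner_of_telescope {f g u w : L2 E} (hf : f ∈ hardy E) (hg : g ∈ hardy E)
    {a : ℕ → ℂ} (ha : Tendsto a atTop (𝓝 0))
    (h : ∀ n : ℕ, a n - a (n + 1) = ⟪mulZ n (constL2 (fourierCoeff f n)), u⟫_ℂ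
      + ⟪w, mulZ n (constL2 (fourierCoeff g n))⟫_ℂ) :
    a 0 = ⟪f, u⟫_ℂ + ⟪w, g⟫_ℂ := by
  have key : ∀ n, a 0 = a n + (⟪trunc n f, u⟫_ℂ + ⟪w, trunc n g⟫_ℂ) := by
    intro n
    induction n with
    | zero => simp [trunc_zero]
    | succ n ih =>
      rw [trunc_succ, trunc_succ, inner_add_left, inner_add_right]
      linear_combination ih + h n
  have l1 : Tendsto (fun n => ⟪trunc n f, u⟫_ℂ) atTop (𝓝 ⟪f, u⟫_ℂ) :=
    (tendsto_trunc hf).inner tendsto_const_nhds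
  have l2 : Tendsto (fun n => ⟪w, trunc n g⟫_ℂ) atTop (𝓝 ⟪w, g⟫_ℂ) :=
    tendsto_const_nhds.inner (tendsto_trunc hg)
  have l := ha.add (l1.add l2)
  rw [zero_add] at l
  exact tendsto_nhds_unique (tendsto_const_nhds.congr key) l

open Filter Topology in
theorem tendsto_inner_apply_zero {K : Type*} [NormedAddCommGroup K] [InnerProductSpace ℂ K]
    (A : K →L[ℂ] K) {u v : ℕ → K} (hu : Tendsto u atTop (𝓝 0)) (hv : Tendsto v atTop (𝓝 0)) :
    Tendsto (fun n => ⟪A (u n), v n⟫_ℂ) atTop (𝓝 0) := by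
  have h := ((A.continuous.tendsto 0).comp hu).inner (𝕜 := ℂ) hv
  rw [inner_zero_right] at h
  exact h

/-- The sesquilinear form of the defect relation. -/
theorem DefectRelation.inner_eq {hΘ : IsInner Θ} {hp : IsPure Θ}
    {A : modelSpace Θ →L[ℂ] modelSpace Θ} {Φ Φ' : L2 (E →L[ℂ] E)}
    (h : DefectRelation hΘ A (symbolOp hΘ hp Φ) (symbolOp hΘ hp Φ')) (f g : modelSpace Θ) :
    ⟪A f, g⟫_ℂ - ⟪A ((modelOp Θ).adjoint f), (modelOp Θ).adjoint g⟫_ℂ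
      = ⟪column (fourierCoeff (f : L2 E) 0) Φ, (g : L2 E)⟫_ℂ
        + ⟪(f : L2 E), column (fourierCoeff (g : L2 E) 0) Φ'⟫_ℂ := by
  have e1 := inner_sub_comp_adjoint A (modelOp Θ) f g
  have e2 := inner_defect_rhs hΘ hp Φ Φ' f g
  have e3 := congrArg (fun T : modelSpace Θ →L[ℂ] modelSpace Θ => ⟪T f, g⟫_ℂ) h
  exact e1.symm.trans (Eq.trans e3 e2)

open Filter Topology in
theorem tendsto_inner_adjoint_modelOp_iterate (hΘ : IsInner Θ)
    (A : modelSpace Θ →L[ℂ] modelSpace Θ) (f g : modelSpace Θ) :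
    Tendsto (fun n => ⟪A (((modelOp Θ).adjoint)^[n] f), ((modelOp Θ).adjoint)^[n] g⟫_ℂ)
      atTop (𝓝 0) :=
  tendsto_inner_apply_zero A (tendsto_adjoint_modelOp_iterate hΘ f)
    (tendsto_adjoint_modelOp_iterate hΘ g)

theorem DefectRelation.inner_iterate {hΘ : IsInner Θ} {hp : IsPure Θ}
    {A : modelSpace Θ →L[ℂ] modelSpace Θ} {Φ Φ' : L2 (E →L[ℂ] E)}
    (h : DefectRelation hΘ A (symbolOp hΘ hp Φ) (symbolOp hΘ hp Φ')) (f g : modelSpace Θ) (n : ℕ) :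
    ⟪A (((modelOp Θ).adjoint)^[n] f), ((modelOp Θ).adjoint)^[n] g⟫_ℂ
        - ⟪A (((modelOp Θ).adjoint)^[n + 1] f), ((modelOp Θ).adjoint)^[n + 1] g⟫_ℂ
      = ⟪column (fourierCoeff (f : L2 E) n) Φ, mulZ (-n) ((g : L2 E) - trunc n (g : L2 E))⟫_ℂ
        + ⟪mulZ (-n) ((f : L2 E) - trunc n (f : L2 E)),
            column (fourierCoeff (g : L2 E) n) Φ'⟫_ℂ := by
  have key : ∀ {u v u' v' : modelSpace Θ} {U V : L2 E} {c d : E}, (u : L2 E) = U → (v : L2 E) = V →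
      fourierCoeff (u : L2 E) 0 = c → fourierCoeff (v : L2 E) 0 = d →
      u' = (modelOp Θ).adjoint u → v' = (modelOp Θ).adjoint v →
      ⟪A u, v⟫_ℂ - ⟪A u', v'⟫_ℂ = ⟪column c Φ, V⟫_ℂ + ⟪U, column d Φ'⟫_ℂ := by
    rintro u v _ _ _ _ _ _ rfl rfl rfl rfl rfl rfl
    exact h.inner_eq u v
  exact key (adjoint_modelOp_iterate hΘ f n) (adjoint_modelOp_iterate hΘ g n)
    (coeff_adjoint_modelOp_iterate hΘ f n) (coeff_adjoint_modelOp_iterate hΘ g n)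
    (Function.iterate_succ_apply' _ n f) (Function.iterate_succ_apply' _ n g)

theorem hasSymbol_of_defectRelation (hΘ : IsInner Θ) (hp : IsPure Θ)
    {A : modelSpace Θ →L[ℂ] modelSpace Θ} {Φ Φ' : L2 (E →L[ℂ] E)}
    (hΦ : Φ ∈ hardy (E →L[ℂ] E)) (hΦ' : Φ' ∈ hardy (E →L[ℂ] E))
    (h : DefectRelation hΘ A (symbolOp hΘ hp Φ) (symbolOp hΘ hp Φ')) :
    HasSymbol Θ A (Φ + star Φ') := by
  rw [hasSymbol_iff_inner hΘ]
  intro f g hf hg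
  -- The partial sums of f and g converge only in L², where multiplication by Φ or Φ' need not be
  -- continuous; hence the symbols are put on the fixed vectors Φ*g and Φ'*f.
  rw [inner_mulOp_left Φ hf hg, ← inner_mulOp_star_left Φ' hf hg]
  refine eq_inner_add_inner_of_telescope f.2.1 g.2.1
    (tendsto_inner_adjoint_modelOp_iterate hΘ A f g) fun n => ?_
  exact (h.inner_iterate f g n).trans (congrArg₂ (· + ·)
    (inner_column_mulZ_sub_trunc hΦ _ n hg) (inner_mulZ_sub_trunc_column hΦ' _ n hf))

end Iteration

end MTTO

end

theorem mainTheorem1 {E : Type*} [NormedAddCommGroup E] [InnerProductSpace ℂ E]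
    [CompleteSpace E] [FiniteDimensional ℂ E] (Θ : MTTO.L2 (E →L[ℂ] E))
    (hΘ : MTTO.IsInner Θ) (hp : MTTO.IsPure Θ)
    (A : MTTO.modelSpace Θ →L[ℂ] MTTO.modelSpace Θ) :
    (MTTO.IsMTTO Θ A ↔
      ∃ B B' : MTTO.defectSpace Θ →L[ℂ] MTTO.modelSpace Θ, MTTO.DefectRelation hΘ A B B') ∧
    (∀ B B' : MTTO.defectSpace Θ →L[ℂ] MTTO.modelSpace Θ, MTTO.DefectRelation hΘ A B B' →
      ∃ Φ ∈ MTTO.hardy (E →L[ℂ] E), ∃ Φ' ∈ MTTO.hardy (E →L[ℂ] E),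
        MTTO.HasSymbol Θ A (Φ + star Φ') ∧
          B = MTTO.symbolOp hΘ hp Φ ∧ B' = MTTO.symbolOp hΘ hp Φ') ∧
    (∀ Φ ∈ MTTO.hardy (E →L[ℂ] E), ∀ Φ' ∈ MTTO.hardy (E →L[ℂ] E),
      MTTO.HasSymbol Θ A (Φ + star Φ') →
        MTTO.DefectRelation hΘ A (MTTO.symbolOp hΘ hp Φ) (MTTO.symbolOp hΘ hp Φ')) := by
  have h2 : ∀ B B' : MTTO.defectSpace Θ →L[ℂ] MTTO.modelSpace Θ,
      MTTO.DefectRelation hΘ A B B' →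
      ∃ Φ ∈ MTTO.hardy (E →L[ℂ] E), ∃ Φ' ∈ MTTO.hardy (E →L[ℂ] E),
        MTTO.HasSymbol Θ A (Φ + star Φ') ∧
          B = MTTO.symbolOp hΘ hp Φ ∧ B' = MTTO.symbolOp hΘ hp Φ' := by
    intro B B' h
    obtain ⟨Φ, hΦ, rfl⟩ := MTTO.exists_symbolOp_eq hΘ hp B
    obtain ⟨Φ', hΦ', rfl⟩ := MTTO.exists_symbolOp_eq hΘ hp B'
    exact ⟨Φ, hΦ, Φ', hΦ', MTTO.hasSymbol_of_defectRelation hΘ hp hΦ hΦ' h, rfl, rfl⟩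
  refine ⟨⟨?_, ?_⟩, h2, fun Φ hΦ Φ' hΦ' h =>
    MTTO.defectRelation_of_hasSymbol hΘ hp hΦ hΦ' h⟩
  · rintro ⟨Ψ, hΨ⟩
    obtain ⟨Φ, hΦ, Φ', hΦ', rfl⟩ := MTTO.exists_eq_add_star Ψ
    exact ⟨_, _, MTTO.defectRelation_of_hasSymbol hΘ hp hΦ hΦ' hΨ⟩
  · rintro ⟨B, B', h⟩
    obtain ⟨Φ, -, Φ', -, h, -⟩ := h2 B B' h
    exact ⟨_, h⟩
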